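/- Let $(X,Y)$ be a pair of real random variables with joint law $P_{XY}$, $\mathbb E[Y^2]<\infty$ and $\mathrm{var}(Y)>0$. A privacy filter is a channel (Markov kernel) $P_{Z|Y}$ from $\mathbb R$ to $\mathbb R$; $Z$ denotes its output when the input is $Y$, so that $X - Y - Z$ is a Markov chain. Fix one of the following two classes $\mathcal K$ of filters: all filters whose output takes values in some finite subset of $\mathbb R$ (the usual class if $X$ and $Y$ take finitely many values), or all real-valued filters. Let $\mathrm{mmse}(U|V)=\inf_g\mathbb E[(U-g(V))^2]$ over Borel functions $g$, and let $\eta_V^2(U)=\mathrm{var}(\mathbb E[U|V])/\mathrm{var}(U)$ (read as $0$ if $\mathrm{var}(U)=0$). Let $\rho_m^2(U;V)$ be the supremum of $\mathbb E^2[f(U)g(V)]/(\mathrm{var}(f(U))\,\mathrm{var}(g(V)))$ over all measurable $f,g$ such that $f(U)$ and $g(V)$ have mean zero and positive finite variance ($0$ if there are none). For $\varepsilon\ge 0$ put $$M_\varepsilon(X;Y)=\inf \frac{\mathrm{mmse}(Y|Z)}{\mathrm{var}(Y)},$$ the infimum being over all $P_{Z|Y}\in\mathcal K$ with $\mathrm{mmse}(f(X)|Z)\ge(1-\varepsilon)\,\mathrm{var}(f(X))$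 for every Borel $f$ such that $0<\mathrm{var}(f(X))<\infty$. If $\mathbb E[X^2]<\infty$, define $W_\varepsilon(X;Y)$ in the same way, with the constraint required only for $f(x)=x$, that is, $\mathrm{mmse}(X|Z)\ge(1-\varepsilon)\,\mathrm{var}(X)$. Let $n\ge 1$, let $(X^n,Y^n)$ consist of $n$ i.i.d. copies $(X_i,Y_i)$ of $(X,Y)$, and consider only memoryless filters $P_{Z^n|Y^n}(\cdot|y^n)=\prod_{i=1}^n P_i(\cdot|y_i)$ with $P_1,\dots,P_n\in\mathcal K$, possibly different. Let $$M_\varepsilon(X^n;Y^n)=1-\frac1n\sup\sum_{i=1}^n\eta^2_{Z^n}(Y_i),$$ the supremum being over all memoryless filters with $\rho_m^2(X^n;Z^n)\le\varepsilon$, and, if $\mathbb E[X^2]<\infty$, let $W_\varepsilon(X^n;Y^n)$ be given by the same formula with the supremum over all memoryless filters with $\sum_{i=1}^n\eta^2_{Z^n}(X_i)\le n\varepsilon$. Then, for every $\varepsilon\ge0$ and $n\ge1$, $$M_\varepsilon(X^n;Y^n)=M_\varepsilon(X;Y),$$ and, if $\mathbb E[X^2]<\infty$, $$W_\varepsilon(X^n;Y^n)=W_\varepsilon(X;Y).$$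 -/

import Mathlib

open MeasureTheory ProbabilityTheory

noncomputable section

namespace PrivacyMMSE

/-- The minimum mean-squared error `mmse(U|V) = inf_g E[(U - g(V))²]` of estimating the real random
variable `U` from the random variable `V`; `g` ranges over all measurable functions. The
expectation of a nonnegative function is taken in `[0, ∞]`; the infimum is finite whenever `U` is
square integrable. -/
def mmse {Ω 𝒱 : Type*} [MeasurableSpace Ω] [MeasurableSpace 𝒱] (μ : Measure Ω)
    (U : Ω → ℝ) (V : Ω → 𝒱) : ℝ :=
  (⨅ g : {g : 𝒱 → ℝ // Measurable g}, ∫⁻ ω, ENNReal.ofReal ((U ω - g.1 (V ω)) ^ 2) ∂μ).toReal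

/-- The (squared) correlation ratio `η²_V(U) = var(E[U|V]) / var(U)`. -/
def corrRatioSq {Ω 𝒱 : Type*} [MeasurableSpace Ω] [m𝒱 : MeasurableSpace 𝒱] (μ : Measure Ω)
    (U : Ω → ℝ) (V : Ω → 𝒱) : ℝ :=
  Var[μ[U | MeasurableSpace.comap V m𝒱]; μ] / Var[U; μ]

/-- The squared maximal correlation `ρ_m²(U;V)`: the supremum of
`E²[f(U) g(V)] / (var(f(U)) var(g(V)))` over all measurable real functions `f`, `g` for which
`f(U)` and `g(V)` have mean zero and positive finite variance. (The supremum is over a set bounded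
by `1`, and it is `0` if there is no such pair.) -/
def maxCorrSq {Ω 𝒰 𝒱 : Type*} [MeasurableSpace Ω] [MeasurableSpace 𝒰] [MeasurableSpace 𝒱]
    (μ : Measure Ω) (U : Ω → 𝒰) (V : Ω → 𝒱) : ℝ :=
  sSup {r : ℝ | ∃ (f : 𝒰 → ℝ) (g : 𝒱 → ℝ), Measurable f ∧ Measurable g ∧
    MemLp (fun ω => f (U ω)) 2 μ ∧ MemLp (fun ω => g (V ω)) 2 μ ∧
    (∫ ω, f (U ω) ∂μ) = 0 ∧ (∫ ω, g (V ω) ∂μ) = 0 ∧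
    0 < Var[fun ω => f (U ω); μ] ∧ 0 < Var[fun ω => g (V ω); μ] ∧
    r = (∫ ω, f (U ω) * g (V ω) ∂μ) ^ 2 /
      (Var[fun ω => f (U ω); μ] * Var[fun ω => g (V ω); μ])}

/-- The law of `((X, Y), Z)` when `(X, Y)` has law `P` and `Z` is the output of the channel
`κ = P_{Z|Y}` with input `Y`, so that `X`, `Y`, `Z` form a Markov chain in this order. -/
def jointLaw {𝒳 𝒴 𝒵 : Type*} [MeasurableSpace 𝒳] [MeasurableSpace 𝒴] [MeasurableSpace 𝒵]
    (P : Measure (𝒳 × 𝒴)) (κ : Kernel 𝒴 𝒵) : Measure ((𝒳 × 𝒴) × 𝒵) :=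
  P ⊗ₘ (κ.comap Prod.snd measurable_snd)

/-- All channels whose output takes values in the alphabet `ℝ`. -/
def realChannels : Set (Kernel ℝ ℝ) := {κ | IsMarkovKernel κ}

/-- All channels whose output takes values in some finite alphabet contained in `ℝ`. -/
def finiteChannels : Set (Kernel ℝ ℝ) :=
  {κ | IsMarkovKernel κ ∧ ∃ A : Set ℝ, A.Finite ∧ ∀ y, κ y Aᶜ = 0}

/-! ### One observation -/

/-- The channels in the class `𝒦` whose output satisfies `ε`-strong estimation privacy:
`mmse(f(X)|Z) ≥ (1 - ε) var(f(X))` for every Borel `f` such that `f(X)` is non-degenerate (and has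
finite variance). -/
def strongFilters (𝒦 : Set (Kernel ℝ ℝ)) (ε : ℝ) (P : Measure (ℝ × ℝ)) : Set (Kernel ℝ ℝ) :=
  {κ | κ ∈ 𝒦 ∧ ∀ f : ℝ → ℝ, Measurable f →
    MemLp (fun w => f w.1.1) 2 (jointLaw P κ) → 0 < Var[fun w => f w.1.1; jointLaw P κ] →
    (1 - ε) * Var[fun w => f w.1.1; jointLaw P κ] ≤
      mmse (jointLaw P κ) (fun w => f w.1.1) (fun w => w.2)}

/-- The channels in the class `𝒦` whose output satisfies `ε`-weak estimation privacy:
`mmse(X|Z) ≥ (1 - ε) var(X)`. -/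
def weakFilters (𝒦 : Set (Kernel ℝ ℝ)) (ε : ℝ) (P : Measure (ℝ × ℝ)) : Set (Kernel ℝ ℝ) :=
  {κ | κ ∈ 𝒦 ∧ (1 - ε) * Var[fun w => w.1.1; jointLaw P κ] ≤
    mmse (jointLaw P κ) (fun w => w.1.1) (fun w => w.2)}

/-- The estimation noise to signal ratio `mmse(Y|Z) / var(Y)`. -/
def ensr (P : Measure (ℝ × ℝ)) (κ : Kernel ℝ ℝ) : ℝ :=
  mmse (jointLaw P κ) (fun w => w.1.2) (fun w => w.2) / Var[fun w => w.1.2; jointLaw P κ]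

/-- The strong privacy-aware estimation noise to signal ratio `M_ε(X;Y)`. -/
def strongENSR (𝒦 : Set (Kernel ℝ ℝ)) (ε : ℝ) (P : Measure (ℝ × ℝ)) : ℝ :=
  sInf (ensr P '' strongFilters 𝒦 ε P)

/-- The weak privacy-aware estimation noise to signal ratio `W_ε(X;Y)`. -/
def weakENSR (𝒦 : Set (Kernel ℝ ℝ)) (ε : ℝ) (P : Measure (ℝ × ℝ)) : ℝ :=
  sInf (ensr P '' weakFilters 𝒦 ε P)

/-! ### Several observations -/

/-- The law of `(Xⁿ, Yⁿ)` for `n` i.i.d. copies of a pair `(X, Y)` with law `P`. -/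
def iidLaw (n : ℕ) (P : Measure (ℝ × ℝ)) : Measure ((Fin n → ℝ) × (Fin n → ℝ)) :=
  (Measure.pi fun _ : Fin n => P).map fun w => (fun i => (w i).1, fun i => (w i).2)

/-- The memoryless channels `P_{Zⁿ|Yⁿ}(zⁿ|yⁿ) = ∏ᵢ Pᵢ(zᵢ|yᵢ)`, with all the `Pᵢ` in the
class `𝒦`. -/
def memorylessChannels (n : ℕ) (𝒦 : Set (Kernel ℝ ℝ)) : Set (Kernel (Fin n → ℝ) (Fin n → ℝ)) :=
  {W | ∃ κ : Fin n → Kernel ℝ ℝ, (∀ i, κ i ∈ 𝒦) ∧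
    ∀ y, W y = Measure.pi fun i => κ i (y i)}

/-- The channels in the class `𝒲` with `ρ_m²(Xⁿ;Zⁿ) ≤ ε`, for `(Xⁿ, Yⁿ)` with law `Q`. -/
def strongFiltersN {n : ℕ} (𝒲 : Set (Kernel (Fin n → ℝ) (Fin n → ℝ))) (ε : ℝ)
    (Q : Measure ((Fin n → ℝ) × (Fin n → ℝ))) : Set (Kernel (Fin n → ℝ) (Fin n → ℝ)) :=
  {W | IsMarkovKernel W ∧ W ∈ 𝒲 ∧
    maxCorrSq (jointLaw Q W) (fun w => w.1.1) (fun w => w.2) ≤ ε}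

/-- The channels in the class `𝒲` with `∑ᵢ η²_{Zⁿ}(Xᵢ) ≤ n ε`, for `(Xⁿ, Yⁿ)` with law `Q`. -/
def weakFiltersN {n : ℕ} (𝒲 : Set (Kernel (Fin n → ℝ) (Fin n → ℝ))) (ε : ℝ)
    (Q : Measure ((Fin n → ℝ) × (Fin n → ℝ))) : Set (Kernel (Fin n → ℝ) (Fin n → ℝ)) :=
  {W | IsMarkovKernel W ∧ W ∈ 𝒲 ∧
    ∑ i, corrRatioSq (jointLaw Q W) (fun w => w.1.1 i) (fun w => w.2) ≤ n * ε}

/-- The total utility `∑ᵢ η²_{Zⁿ}(Yᵢ)`. -/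
def sumCorrRatioSq {n : ℕ} (Q : Measure ((Fin n → ℝ) × (Fin n → ℝ)))
    (W : Kernel (Fin n → ℝ) (Fin n → ℝ)) : ℝ :=
  ∑ i, corrRatioSq (jointLaw Q W) (fun w => w.1.2 i) (fun w => w.2)

/-- `M_ε(Xⁿ;Yⁿ)`, with the optimization restricted to filters in the class `𝒲`. -/
def strongENSRN {n : ℕ} (𝒲 : Set (Kernel (Fin n → ℝ) (Fin n → ℝ))) (ε : ℝ)
    (Q : Measure ((Fin n → ℝ) × (Fin n → ℝ))) : ℝ :=
  1 - 1 / (n : ℝ) * sSup (sumCorrRatioSq Q '' strongFiltersN 𝒲 ε Q)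

/-- `W_ε(Xⁿ;Yⁿ)`, with the optimization restricted to filters in the class `𝒲`. -/
def weakENSRN {n : ℕ} (𝒲 : Set (Kernel (Fin n → ℝ) (Fin n → ℝ))) (ε : ℝ)
    (Q : Measure ((Fin n → ℝ) × (Fin n → ℝ))) : ℝ :=
  1 - 1 / (n : ℝ) * sSup (sumCorrRatioSq Q '' weakFiltersN 𝒲 ε Q)

end PrivacyMMSE

end

/-! A memoryless filter fed with an i.i.d. source makes the triples `(Xᵢ, Yᵢ, Zᵢ)` independent
(`jointLaw_iidLaw`), so the outputs other than `Zᵢ` do not help to estimate `Xᵢ` or `Yᵢ`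
(`emmse_pi`). The total utility is therefore the sum of the single-letter utilities `1 - ensr P (κ
i)`, and only the privacy constraints remain to be compared. Using one private filter `n` times
gives one inequality; the other needs a single-letter filter at least as good as the average
component.

Strong privacy: the conditional expectation is the best estimator, so strong privacy of a channel is
the same as a bound on its maximal correlation. The passage from mean-squared error to correlation
is `corrBound_of_mmse`, the converse is `le_mmse_of_maxCorrSq_le`. The bound tensorizes
(`CorrBound.pi`), so a memoryless filter is private exactly when every component is, and each
component obeys the single-letter bound.

Weak privacy: only the average leakage is constrained, and single components may violate the bound.
Time sharing repairs this. A channel that draws `i` uniformly, applies `κ i` and reveals `i` has as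
its minimum mean-squared error the average over the components, both for `X` and for `Y`
(`mmse_timeSharing`). It is thus weakly private, and its noise to signal ratio is the average one.
-/

namespace PrivacyMMSE

/-! ### Minimum mean-squared error and conditional expectation. -/

section Estimation

variable {Ω 𝒱 : Type*} [MeasurableSpace Ω] [m𝒱 : MeasurableSpace 𝒱] {μ : Measure Ω}
  {U : Ω → ℝ} {V : Ω → 𝒱}

/-- The mean-squared error of the estimator `g(V)` of `U`. -/
noncomputable def mse (μ : Measure Ω) (U : Ω → ℝ) (V : Ω → 𝒱) (g : 𝒱 → ℝ) : ENNReal :=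
  ∫⁻ ω, ENNReal.ofReal ((U ω - g (V ω)) ^ 2) ∂μ

/-- The `[0, ∞]`-valued minimum mean-squared error. -/
noncomputable def emmse (μ : Measure Ω) (U : Ω → ℝ) (V : Ω → 𝒱) : ENNReal :=
  ⨅ g : {g : 𝒱 → ℝ // Measurable g}, mse μ U V g.1

lemma mmse_eq_toReal_emmse (μ : Measure Ω) (U : Ω → ℝ) (V : Ω → 𝒱) :
    mmse μ U V = (emmse μ U V).toReal := rfl

lemma mmse_nonneg (μ : Measure Ω) (U : Ω → ℝ) (V : Ω → 𝒱) : 0 ≤ mmse μ U V :=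
  ENNReal.toReal_nonneg

lemma emmse_le_mse (μ : Measure Ω) (U : Ω → ℝ) (V : Ω → 𝒱) {g : 𝒱 → ℝ} (hg : Measurable g) :
    emmse μ U V ≤ mse μ U V g :=
  iInf_le (fun g : {g : 𝒱 → ℝ // Measurable g} => mse μ U V g.1) ⟨g, hg⟩

lemma mse_eq_ofReal_integral {𝒱 : Type*} {V : Ω → 𝒱} {g : 𝒱 → ℝ} (h : MemLp (fun ω => U ω - g (V ω)) 2 μ) :
    mse μ U V g = ENNReal.ofReal (∫ ω, (U ω - g (V ω)) ^ 2 ∂μ) := by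
  rw [mse, ofReal_integral_eq_lintegral_ofReal h.integrable_sq]
  exact Filter.Eventually.of_forall fun ω => sq_nonneg _

lemma memLp_of_mse_ne_top {g : 𝒱 → ℝ} (hU : AEStronglyMeasurable U μ) (hV : Measurable V)
    (hg : Measurable g) (h : mse μ U V g ≠ ⊤) : MemLp (fun ω => U ω - g (V ω)) 2 μ := by
  have hm : AEStronglyMeasurable (fun ω => U ω - g (V ω)) μ :=
    hU.sub (hg.comp hV).aestronglyMeasurable
  rw [memLp_two_iff_integrable_sq hm]
  refine ⟨hm.pow 2, ?_⟩
  rw [hasFiniteIntegral_iff_ofReal (Filter.Eventually.of_forall fun ω => sq_nonneg _)]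
  exact lt_top_iff_ne_top.2 h

lemma integral_sq_sub_condExp_le {Ω : Type*} {m m0 : MeasurableSpace Ω} {μ : Measure[m0] Ω}
    [IsFiniteMeasure μ] (hm : m ≤ m0) {X : Ω → ℝ} (hX : MemLp X 2 μ) :
    ∫ ω, (X ω - (μ[X | m]) ω) ^ 2 ∂μ ≤ ∫ ω, X ω ^ 2 ∂μ := by
  have h1 : ∫ ω, (X ω - (μ[X | m]) ω) ^ 2 ∂μ = μ[Var[X; μ | m]] := (integral_condExp hm).symm
  have h2 : ∫ ω, X ω ^ 2 ∂μ = μ[μ[X ^ 2 | m]] := (integral_condExp hm).symm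
  rw [h1, h2]
  exact integral_mono_ae integrable_condVar integrable_condExp (condVar_ae_le_condExp_sq hm hX)

lemma emmse_map {Ω' : Type*} [MeasurableSpace Ω'] {R : Ω → Ω'} (hR : Measurable R)
    {U : Ω' → ℝ} (hU : Measurable U) {V : Ω' → 𝒱} (hV : Measurable V) :
    emmse (μ.map R) U V = emmse μ (fun ω => U (R ω)) (fun ω => V (R ω)) := by
  refine iInf_congr fun g => ?_
  rw [mse, lintegral_map _ hR, mse]
  have := g.2
  fun_prop

lemma mmse_map {Ω' : Type*} [MeasurableSpace Ω'] {R : Ω → Ω'} (hR : Measurable R)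
    {U : Ω' → ℝ} (hU : Measurable U) {V : Ω' → 𝒱} (hV : Measurable V) :
    mmse (μ.map R) U V = mmse μ (fun ω => U (R ω)) (fun ω => V (R ω)) := by
  rw [mmse_eq_toReal_emmse, emmse_map hR hU hV, mmse_eq_toReal_emmse]

lemma mmse_le_integral (hU : MemLp U 2 μ) {g : 𝒱 → ℝ} (hg : Measurable g)
    (hgL : MemLp (fun ω => g (V ω)) 2 μ) : mmse μ U V ≤ ∫ ω, (U ω - g (V ω)) ^ 2 ∂μ := by
  rw [mmse_eq_toReal_emmse]
  refine ENNReal.toReal_le_of_le_ofReal (integral_nonneg fun ω => sq_nonneg _) ?_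
  rw [← mse_eq_ofReal_integral (hU.sub hgL)]
  exact emmse_le_mse μ U V hg

/-- The function `g` is the Doob–Dynkin factor of `E[U|V]`. It is optimal because subtracting from
the error `U - h(V)` its own conditional expectation leaves `U - g(V)`, and this cannot increase the
second moment. The value of the error is the law of total variance. -/
lemma exists_measurable_condExp_comap (hV : Measurable V) (hU : MemLp U 2 μ)
    [IsProbabilityMeasure μ] :
    ∃ g : 𝒱 → ℝ, Measurable g ∧ μ[U | MeasurableSpace.comap V m𝒱] = g ∘ V ∧
      MemLp (fun ω => g (V ω)) 2 μ ∧
      emmse μ U V = mse μ U V g ∧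
      mse μ U V g = ENNReal.ofReal (Var[U; μ] - Var[fun ω => g (V ω); μ]) := by
  have hm := hV.comap_le
  obtain ⟨g, hg, hgV⟩ :=
    (stronglyMeasurable_condExp (μ := μ) (f := U)
      (m := MeasurableSpace.comap V m𝒱)).exists_eq_measurable_comp
  have hgL : MemLp (fun ω => g (V ω)) 2 μ := by
    have := hU.condExp (m := MeasurableSpace.comap V m𝒱) one_le_two
    rwa [hgV] at this
  have hpt : ∀ ω, (μ[U | MeasurableSpace.comap V m𝒱]) ω = g (V ω) := fun ω => congrFun hgV ω
  have hmse := mse_eq_ofReal_integral (g := g) (V := V) (hU.sub hgL)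
  have hint : ∫ ω, (U ω - g (V ω)) ^ 2 ∂μ = μ[Var[U; μ | MeasurableSpace.comap V m𝒱]] := by
    rw [show Var[U; μ | MeasurableSpace.comap V m𝒱] = _ from rfl, condVar, integral_condExp hm]
    simp [hpt]
  refine ⟨g, hg.measurable, hgV, hgL, le_antisymm (emmse_le_mse μ U V hg.measurable) ?_, ?_⟩
  · refine le_iInf fun h => ?_
    -- Competitors need not be square integrable; those that are not have infinite error.
    by_cases htop : mse μ U V h.1 = ⊤
    · rw [htop]; exact le_top
    have hL := memLp_of_mse_ne_top hU.1 hV h.2 htop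
    have hhL : MemLp (fun ω => h.1 (V ω)) 2 μ := by
      have := hU.sub hL
      refine this.ae_eq (Filter.Eventually.of_forall fun ω => ?_)
      simp
    rw [hmse, mse_eq_ofReal_integral hL]
    refine ENNReal.ofReal_le_ofReal ?_
    refine le_trans (le_of_eq ?_) (integral_sq_sub_condExp_le hm hL)
    refine integral_congr_ae ?_
    have h1 := condExp_sub (m := MeasurableSpace.comap V m𝒱) (hU.integrable one_le_two)
      (hhL.integrable one_le_two)
    have h2 : μ[fun ω => h.1 (V ω) | MeasurableSpace.comap V m𝒱] = fun ω => h.1 (V ω) :=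
      condExp_of_stronglyMeasurable hm
        ((h.2.comp (comap_measurable V)).stronglyMeasurable) (hhL.integrable one_le_two)
    filter_upwards [h1] with ω hω
    rw [Pi.sub_apply, h2] at hω
    change (U ω - g (V ω)) ^ 2 =
      (U ω - h.1 (V ω) - (μ[U - fun ω => h.1 (V ω) | MeasurableSpace.comap V m𝒱]) ω) ^ 2
    rw [hω, hpt]
    ring
  · rw [hmse, hint, ← integral_condVar_add_variance_condExp hm hU, hgV]
    congr 1
    simp [Function.comp_def]

variable [IsProbabilityMeasure μ]

lemma exists_mse_eq_emmse (hV : Measurable V) (hU : MemLp U 2 μ) :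
    ∃ g : 𝒱 → ℝ, Measurable g ∧ emmse μ U V = mse μ U V g := by
  obtain ⟨g, hg, -, -, h, -⟩ := exists_measurable_condExp_comap hV hU
  exact ⟨g, hg, h⟩

lemma emmse_ne_top (hV : Measurable V) (hU : MemLp U 2 μ) : emmse μ U V ≠ ⊤ := by
  obtain ⟨g, -, -, -, h1, h2⟩ := exists_measurable_condExp_comap hV hU
  rw [h1, h2]
  exact ENNReal.ofReal_ne_top

/-- The law of total variance for the minimum mean-squared error. -/
lemma mmse_eq_variance_sub (hV : Measurable V) (hU : MemLp U 2 μ) :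
    mmse μ U V = Var[U; μ] - Var[μ[U | MeasurableSpace.comap V m𝒱]; μ] := by
  obtain ⟨g, -, hgV, -, h1, h2⟩ := exists_measurable_condExp_comap hV hU
  have h3 := integral_condVar_add_variance_condExp hV.comap_le hU
  have h4 : 0 ≤ μ[Var[U; μ | MeasurableSpace.comap V m𝒱]] := by
    rw [condVar, integral_condExp hV.comap_le]
    exact integral_nonneg fun ω => sq_nonneg _
  rw [mmse_eq_toReal_emmse, h1, h2, hgV]
  rw [hgV] at h3
  refine ENNReal.toReal_ofReal ?_
  change 0 ≤ Var[U; μ] - Var[g ∘ V; μ]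
  linarith

lemma corrRatioSq_eq (hV : Measurable V) (hU : MemLp U 2 μ) :
    corrRatioSq μ U V = (Var[U; μ] - mmse μ U V) / Var[U; μ] := by
  rw [mmse_eq_variance_sub hV hU, corrRatioSq]
  ring

/-- If the variance vanishes, the ratio is `0` by the convention for division and both sides hold,
the left one because `0 ≤ ε`. -/
lemma corrRatioSq_le_iff (hV : Measurable V) (hU : MemLp U 2 μ) {ε : ℝ} (hε : 0 ≤ ε) :
    corrRatioSq μ U V ≤ ε ↔ (1 - ε) * Var[U; μ] ≤ mmse μ U V := by
  rw [corrRatioSq_eq hV hU]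
  rcases (variance_nonneg U μ).eq_or_lt with h | h
  · rw [← h]
    simp [hε, mmse_nonneg]
  · rw [div_le_iff₀ h]
    constructor <;> intro <;> linarith

/-- A constant observation is useless. -/
lemma mmse_eq_variance_of_const (hU : MemLp U 2 μ) (hV : Measurable V) {z : 𝒱}
    (hz : ∀ᵐ ω ∂μ, V ω = z) : mmse μ U V = Var[U; μ] := by
  rw [mmse_eq_variance_sub hV hU]
  obtain ⟨g, -, hgV, -⟩ := exists_measurable_condExp_comap hV hU
  have : μ[U | MeasurableSpace.comap V m𝒱] =ᵐ[μ] fun _ => g z := by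
    rw [hgV]
    filter_upwards [hz] with ω hω
    simp [hω]
  rw [variance_congr this]
  simp [variance_eq_integral]

end Estimation

/-! ### Maximal correlation and its link with estimation. -/

section MaximalCorrelation

variable {Ω 𝒰 𝒱 : Type*} [MeasurableSpace Ω] [MeasurableSpace 𝒰] [MeasurableSpace 𝒱]
  {μ : Measure Ω} {U : Ω → 𝒰} {V : Ω → 𝒱} {ε : ℝ}

/-- A quadratic-form version of `ρ_m²(U;V) ≤ ε`, which tensorizes by integration. -/
def CorrBound (ε : ℝ) (μ : Measure Ω) (U : Ω → 𝒰) (V : Ω → 𝒱) : Prop :=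
  ∀ (f : 𝒰 → ℝ) (g : 𝒱 → ℝ), Measurable f → Measurable g →
    MemLp (fun ω => f (U ω)) 2 μ → MemLp (fun ω => g (V ω)) 2 μ →
    2 * cov[fun ω => f (U ω), fun ω => g (V ω); μ] ≤
      ε * Var[fun ω => f (U ω); μ] + Var[fun ω => g (V ω); μ]

lemma corrBound_one [IsFiniteMeasure μ] : CorrBound 1 μ U V := by
  intro f g _ _ hf hg
  have h := variance_fun_sub hf hg
  have := variance_nonneg (fun ω => f (U ω) - g (V ω)) μ
  linarith

/-- Replacing `g` by `t * g` gives a quadratic polynomial in `t` that is nowhere negative, so its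
discriminant is at most zero. -/
lemma CorrBound.sq_covariance_le (h : CorrBound ε μ U V) {f : 𝒰 → ℝ} {g : 𝒱 → ℝ}
    (hf : Measurable f) (hg : Measurable g) (hfL : MemLp (fun ω => f (U ω)) 2 μ)
    (hgL : MemLp (fun ω => g (V ω)) 2 μ) :
    cov[fun ω => f (U ω), fun ω => g (V ω); μ] ^ 2 ≤
      ε * (Var[fun ω => f (U ω); μ] * Var[fun ω => g (V ω); μ]) := by
  have key : ∀ t : ℝ, 0 ≤ Var[fun ω => g (V ω); μ] * (t * t) +
      (-2 * cov[fun ω => f (U ω), fun ω => g (V ω); μ]) * t + ε * Var[fun ω => f (U ω); μ] := by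
    intro t
    have := h f (fun v => t * g v) hf (hg.const_mul t) hfL (hgL.const_mul t)
    rw [covariance_const_mul_right, variance_const_mul] at this
    linarith
  have := discrim_le_zero key
  rw [discrim] at this
  linarith

lemma CorrBound.sq_integral_div_le [IsProbabilityMeasure μ] (h : CorrBound ε μ U V)
    {f : 𝒰 → ℝ} {g : 𝒱 → ℝ}
    (hf : Measurable f) (hg : Measurable g) (hfL : MemLp (fun ω => f (U ω)) 2 μ)
    (hgL : MemLp (fun ω => g (V ω)) 2 μ) (hf0 : ∫ ω, f (U ω) ∂μ = 0)
    (hfV : 0 < Var[fun ω => f (U ω); μ]) (hgV : 0 < Var[fun ω => g (V ω); μ]) :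
    (∫ ω, f (U ω) * g (V ω) ∂μ) ^ 2 / (Var[fun ω => f (U ω); μ] * Var[fun ω => g (V ω); μ]) ≤
      ε := by
  have h1 := h.sq_covariance_le hf hg hfL hgL
  rw [covariance_eq_sub hfL hgL, hf0, zero_mul, sub_zero] at h1
  rw [div_le_iff₀ (mul_pos hfV hgV)]
  exact h1

lemma CorrBound.maxCorrSq_le [IsProbabilityMeasure μ] (h : CorrBound ε μ U V) (hε : 0 ≤ ε) :
    maxCorrSq μ U V ≤ ε := by
  refine Real.sSup_le ?_ hε
  rintro r ⟨f, g, hf, hg, hfL, hgL, hf0, -, hfV, hgV, rfl⟩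
  exact h.sq_integral_div_le hf hg hfL hgL hf0 hfV hgV

lemma le_maxCorrSq [IsProbabilityMeasure μ] {f : 𝒰 → ℝ} {g : 𝒱 → ℝ}
    (hf : Measurable f) (hg : Measurable g) (hfL : MemLp (fun ω => f (U ω)) 2 μ)
    (hgL : MemLp (fun ω => g (V ω)) 2 μ) (hf0 : ∫ ω, f (U ω) ∂μ = 0)
    (hg0 : ∫ ω, g (V ω) ∂μ = 0)
    (hfV : 0 < Var[fun ω => f (U ω); μ]) (hgV : 0 < Var[fun ω => g (V ω); μ]) :
    (∫ ω, f (U ω) * g (V ω) ∂μ) ^ 2 / (Var[fun ω => f (U ω); μ] * Var[fun ω => g (V ω); μ]) ≤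
      maxCorrSq μ U V := by
  -- The upper bound `1` is the Cauchy–Schwarz inequality, in the form `corrBound_one`.
  refine le_csSup ⟨1, ?_⟩ ⟨f, g, hf, hg, hfL, hgL, hf0, hg0, hfV, hgV, rfl⟩
  rintro r ⟨f, g, hf, hg, hfL, hgL, hf0, -, hfV, hgV, rfl⟩
  exact corrBound_one.sq_integral_div_le hf hg hfL hgL hf0 hfV hgV

/-- Strong estimation privacy bounds the correlation of all functions of `U` and `V`. -/
lemma corrBound_of_mmse [IsProbabilityMeasure μ]
    (h : ∀ f : 𝒰 → ℝ, Measurable f → MemLp (fun ω => f (U ω)) 2 μ →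
      0 < Var[fun ω => f (U ω); μ] →
      (1 - ε) * Var[fun ω => f (U ω); μ] ≤ mmse μ (fun ω => f (U ω)) V) :
    CorrBound ε μ U V := by
  intro f g hf hg hfL hgL
  have h1 : (1 - ε) * Var[fun ω => f (U ω); μ] ≤ mmse μ (fun ω => f (U ω)) V := by
    rcases (variance_nonneg (fun ω => f (U ω)) μ).eq_or_lt with h0 | h0
    · rw [← h0, mul_zero]
      exact mmse_nonneg ..
    · exact h f hf hfL h0
  -- After the shift that matches the means, the error of `g(V)` as an estimator of `f(U)` is
  -- `var(f(U) - g(V))`; expanding it produces the covariance.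
  have h2 := mmse_le_integral (V := V) hfL
    (hg.add_const ((∫ ω, f (U ω) ∂μ) - ∫ ω, g (V ω) ∂μ)) (hgL.add (memLp_const _))
  have hd : MemLp (fun ω => f (U ω) - g (V ω)) 2 μ := hfL.sub hgL
  have h3 := variance_fun_sub hfL hgL
  rw [variance_eq_integral hd.1.aemeasurable,
    integral_sub (hfL.integrable one_le_two) (hgL.integrable one_le_two)] at h3
  have h4 : ∫ ω, (f (U ω) - g (V ω) - ((∫ ω, f (U ω) ∂μ) - ∫ ω, g (V ω) ∂μ)) ^ 2 ∂μ =
      ∫ ω, (f (U ω) - (g (V ω) + ((∫ ω, f (U ω) ∂μ) - ∫ ω, g (V ω) ∂μ))) ^ 2 ∂μ := by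
    simp only [sub_sub]
  linarith

/-- A bound on the maximal correlation is a bound on the accuracy with which functions of `U` can
be estimated. -/
lemma le_mmse_of_maxCorrSq_le [IsProbabilityMeasure μ] (hV : Measurable V) (hε : 0 ≤ ε)
    (h : maxCorrSq μ U V ≤ ε) {f : 𝒰 → ℝ} (hf : Measurable f)
    (hfL : MemLp (fun ω => f (U ω)) 2 μ) :
    (1 - ε) * Var[fun ω => f (U ω); μ] ≤ mmse μ (fun ω => f (U ω)) V := by
  have hm := hV.comap_le
  obtain ⟨g, hg, hgE, hgL, -, -⟩ := exists_measurable_condExp_comap hV hfL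
  rw [mmse_eq_variance_sub hV hfL, hgE]
  change _ ≤ _ - Var[fun ω => g (V ω); μ]
  set c := ∫ ω, f (U ω) ∂μ with hc
  have hgc : ∫ ω, g (V ω) ∂μ = c := by
    rw [hc, ← integral_condExp hm (f := fun ω => f (U ω)), hgE]
    rfl
  -- A constant conditional expectation is not admissible in the supremum, but then the claim is
  -- just `0 ≤ ε * var(f(U))`.
  rcases (variance_nonneg (fun ω => g (V ω)) μ).eq_or_lt with h0 | h0
  · rw [← h0]
    nlinarith [variance_nonneg (fun ω => f (U ω)) μ]
  have hle : Var[fun ω => g (V ω); μ] ≤ Var[fun ω => f (U ω); μ] := by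
    have h1 := mmse_nonneg μ (fun ω => f (U ω)) V
    rw [mmse_eq_variance_sub hV hfL, hgE] at h1
    exact sub_nonneg.1 h1
  have hfV := h0.trans_le hle
  have hfg : ∫ ω, f (U ω) * g (V ω) ∂μ = ∫ ω, g (V ω) ^ 2 ∂μ := by
    have hint : Integrable (fun ω => f (U ω) * g (V ω)) μ := hfL.integrable_mul hgL
    rw [← integral_condExp hm (f := fun ω => f (U ω) * g (V ω))]
    have h1 := condExp_mul_of_stronglyMeasurable_right (μ := μ)
      (m := MeasurableSpace.comap V inferInstance)
      (f := fun ω => f (U ω)) (g := fun ω => g (V ω))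
      ((hg.comp (comap_measurable V)).stronglyMeasurable) hint (hfL.integrable one_le_two)
    refine integral_congr_ae ?_
    refine Filter.EventuallyEq.trans h1 (Filter.Eventually.of_forall fun ω => ?_)
    simp only [hgE, Pi.mul_apply, Function.comp_apply]
    ring
  -- Since `g(V) = E[f(U)|V]`, the squared correlation of this pair is `var(g(V)) / var(f(U))`, and
  -- the supremum bounds it by `ε`.
  have hcov : ∫ ω, (f (U ω) - c) * (g (V ω) - c) ∂μ = Var[fun ω => g (V ω); μ] := by
    have h1 : cov[fun ω => f (U ω), fun ω => g (V ω); μ] = Var[fun ω => g (V ω); μ] := by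
      rw [covariance_eq_sub hfL hgL, variance_eq_sub hgL]
      simp only [Pi.mul_apply, Pi.pow_apply]
      rw [hfg, hgc]
      ring
    rw [← h1, covariance, hgc]
  have hle2 := le_maxCorrSq (μ := μ) (U := U) (V := V) (hf.sub_const c) (hg.sub_const c)
    (hfL.sub (memLp_const c)) (hgL.sub (memLp_const c))
    (by rw [integral_sub (hfL.integrable one_le_two) (integrable_const c)]; simp [hc])
    (by rw [integral_sub (hgL.integrable one_le_two) (integrable_const c)]; simp [hgc])
    (by rwa [variance_sub_const hfL.1]) (by rwa [variance_sub_const hgL.1])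
  rw [variance_sub_const hfL.1, variance_sub_const hgL.1, hcov] at hle2
  have h2 := hle2.trans h
  rw [div_le_iff₀ (mul_pos hfV h0)] at h2
  nlinarith

lemma CorrBound.map {Ω' : Type*} [MeasurableSpace Ω'] {R : Ω → Ω'} (hR : Measurable R)
    {U : Ω' → 𝒰} {V : Ω' → 𝒱} (hU : Measurable U) (hV : Measurable V)
    (h : CorrBound ε μ (fun ω => U (R ω)) (fun ω => V (R ω))) : CorrBound ε (μ.map R) U V := by
  intro f g hf hg hfL hgL
  have hfm : Measurable fun ω => f (U ω) := hf.comp hU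
  have hgm : Measurable fun ω => g (V ω) := hg.comp hV
  rw [covariance_map hfm.aestronglyMeasurable hgm.aestronglyMeasurable hR.aemeasurable,
    variance_map hfm.aemeasurable hR.aemeasurable, variance_map hgm.aemeasurable hR.aemeasurable]
  exact h f g hf hg (hfL.comp_of_map hR.aemeasurable) (hgL.comp_of_map hR.aemeasurable)

end MaximalCorrelation

/-! ### Tensorization of the maximal correlation bound. -/

section Tensorization

variable {Ω₁ Ω₂ 𝒰₁ 𝒰₂ 𝒱₁ 𝒱₂ : Type*} [MeasurableSpace Ω₁] [MeasurableSpace Ω₂]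
  [MeasurableSpace 𝒰₁] [MeasurableSpace 𝒰₂] [MeasurableSpace 𝒱₁] [MeasurableSpace 𝒱₂]
  {μ₁ : Measure Ω₁} {μ₂ : Measure Ω₂} [IsProbabilityMeasure μ₁] [IsProbabilityMeasure μ₂]

/-- Averaging over the second coordinate preserves square integrability. -/
lemma memLp_integral_right {F : Ω₁ × Ω₂ → ℝ} (hF : MemLp F 2 (μ₁.prod μ₂)) :
    MemLp (fun x => ∫ y, F (x, y) ∂μ₂) 2 μ₁ := by
  have hm : AEStronglyMeasurable (fun x => ∫ y, F (x, y) ∂μ₂) μ₁ := hF.1.integral_prod_right'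
  rw [memLp_two_iff_integrable_sq hm]
  refine hF.integrable_sq.integral_prod_left.mono' (hm.pow 2) ?_
  have h1 := hF.integrable_sq.prod_right_ae
  have h2 := hF.1.prodMk_left
  filter_upwards [h1, h2] with x hx hx'
  have hL : MemLp (fun y => F (x, y)) 2 μ₂ := (memLp_two_iff_integrable_sq hx').2 hx
  have := variance_nonneg (fun y => F (x, y)) μ₂
  rw [variance_eq_sub hL] at this
  simp only [Pi.pow_apply] at this
  rw [Real.norm_of_nonneg (sq_nonneg _)]
  linarith

/-- By the laws of total variance and covariance, each term splits into the mean of its conditional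
version given the first coordinate and its version for the conditional means. The slices obey `h₂`,
the conditional means obey `h₁`, and the two inequalities add because `CorrBound` is linear in
variances and covariances. -/
lemma CorrBound.prod {ε : ℝ} {U₁ : Ω₁ → 𝒰₁} {U₂ : Ω₂ → 𝒰₂} {V₁ : Ω₁ → 𝒱₁} {V₂ : Ω₂ → 𝒱₂}
    (hU₂ : Measurable U₂) (hV₂ : Measurable V₂)
    (h₁ : CorrBound ε μ₁ U₁ V₁) (h₂ : CorrBound ε μ₂ U₂ V₂) :
    CorrBound ε (μ₁.prod μ₂) (fun w => (U₁ w.1, U₂ w.2)) (fun w => (V₁ w.1, V₂ w.2)) := by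
  intro f g hf hg hfL hgL
  set F : Ω₁ × Ω₂ → ℝ := fun w => f (U₁ w.1, U₂ w.2) with hFdef
  set G : Ω₁ × Ω₂ → ℝ := fun w => g (V₁ w.1, V₂ w.2) with hGdef
  have hFGi : Integrable (fun w => F w * G w) (μ₁.prod μ₂) := hfL.integrable_mul hgL
  have hF1 := memLp_integral_right hfL
  have hG1 := memLp_integral_right hgL
  have hFG1 : Integrable (fun x => (∫ y, F (x, y) ∂μ₂) * ∫ y, G (x, y) ∂μ₂) μ₁ :=
    hF1.integrable_mul hG1
  have hf1 : Measurable fun u : 𝒰₁ => ∫ y, f (u, U₂ y) ∂μ₂ := by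
    have : StronglyMeasurable (fun p : 𝒰₁ × Ω₂ => f (p.1, U₂ p.2)) :=
      (hf.comp (by fun_prop : Measurable fun p : 𝒰₁ × Ω₂ => (p.1, U₂ p.2))).stronglyMeasurable
    exact this.integral_prod_right'.measurable
  have hg1 : Measurable fun v : 𝒱₁ => ∫ y, g (v, V₂ y) ∂μ₂ := by
    have : StronglyMeasurable (fun p : 𝒱₁ × Ω₂ => g (p.1, V₂ p.2)) :=
      (hg.comp (by fun_prop : Measurable fun p : 𝒱₁ × Ω₂ => (p.1, V₂ p.2))).stronglyMeasurable
    exact this.integral_prod_right'.measurable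
  have houter := h₁ _ _ hf1 hg1 hF1 hG1
  rw [covariance_eq_sub hF1 hG1, variance_eq_sub hF1, variance_eq_sub hG1] at houter
  rw [covariance_eq_sub hfL hgL, variance_eq_sub hfL, variance_eq_sub hgL]
  simp only [Pi.mul_apply, Pi.pow_apply] at houter ⊢
  rw [integral_prod _ hFGi, integral_prod _ hfL.integrable_sq, integral_prod _ hgL.integrable_sq,
    integral_prod _ (hfL.integrable one_le_two), integral_prod _ (hgL.integrable one_le_two)]
  have hvF : Integrable (fun x => (∫ y, F (x, y) ^ 2 ∂μ₂) - (∫ y, F (x, y) ∂μ₂) ^ 2) μ₁ :=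
    hfL.integrable_sq.integral_prod_left.sub hF1.integrable_sq
  have hvG : Integrable (fun x => (∫ y, G (x, y) ^ 2 ∂μ₂) - (∫ y, G (x, y) ∂μ₂) ^ 2) μ₁ :=
    hgL.integrable_sq.integral_prod_left.sub hG1.integrable_sq
  have hinner : ∫ x, 2 * ((∫ y, F (x, y) * G (x, y) ∂μ₂) -
        (∫ y, F (x, y) ∂μ₂) * ∫ y, G (x, y) ∂μ₂) ∂μ₁ ≤
      ∫ x, (ε * ((∫ y, F (x, y) ^ 2 ∂μ₂) - (∫ y, F (x, y) ∂μ₂) ^ 2) +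
        ((∫ y, G (x, y) ^ 2 ∂μ₂) - (∫ y, G (x, y) ∂μ₂) ^ 2)) ∂μ₁ := by
    refine integral_mono_ae ((hFGi.integral_prod_left.sub hFG1).const_mul 2)
      ((hvF.const_mul ε).add hvG) ?_
    filter_upwards [hfL.integrable_sq.prod_right_ae, hfL.1.prodMk_left,
      hgL.integrable_sq.prod_right_ae, hgL.1.prodMk_left] with x hfx hfx' hgx hgx'
    have hfxL : MemLp (fun y => F (x, y)) 2 μ₂ := (memLp_two_iff_integrable_sq hfx').2 hfx
    have hgxL : MemLp (fun y => G (x, y)) 2 μ₂ := (memLp_two_iff_integrable_sq hgx').2 hgx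
    have := h₂ (fun u => f (U₁ x, u)) (fun v => g (V₁ x, v)) (hf.comp measurable_prodMk_left)
      (hg.comp measurable_prodMk_left) hfxL hgxL
    rw [covariance_eq_sub hfxL hgxL, variance_eq_sub hfxL, variance_eq_sub hgxL] at this
    exact this
  rw [integral_const_mul, integral_sub hFGi.integral_prod_left hFG1,
    integral_add (hvF.const_mul ε) hvG, integral_const_mul,
    integral_sub hfL.integrable_sq.integral_prod_left hF1.integrable_sq,
    integral_sub hgL.integrable_sq.integral_prod_left hG1.integrable_sq] at hinner
  simp only [hFdef, hGdef] at houter hinner ⊢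
  linarith

variable {Ω 𝒰 𝒱 : Type*} [MeasurableSpace Ω] [MeasurableSpace 𝒰] [MeasurableSpace 𝒱]

/-- Maximal correlation bounds tensorize. -/
lemma CorrBound.pi {ε : ℝ} (hε : 0 ≤ ε) {U : Ω → 𝒰} {V : Ω → 𝒱}
    (hU : Measurable U) (hV : Measurable V) :
    ∀ (n : ℕ) (μ : Fin n → Measure Ω) [∀ i, IsProbabilityMeasure (μ i)],
      (∀ i, CorrBound ε (μ i) U V) →
      CorrBound ε (Measure.pi μ) (fun w i => U (w i)) (fun w i => V (w i)) := by
  intro n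
  induction n with
  | zero =>
    intro μ _ _ f g _ _ _ _
    -- A function of the empty tuple is constant, so the covariance vanishes.
    have h1 : (fun w : Fin 0 → Ω => f fun i => U (w i)) = fun _ => f fun i => i.elim0 := by
      funext w; congr 1; funext i; exact i.elim0
    rw [h1, covariance_const_left]
    rw [mul_zero]
    exact add_nonneg (mul_nonneg hε (variance_nonneg ..)) (variance_nonneg ..)
  | succ n ih =>
    intro μ _ h
    have hmp := (measurePreserving_piFinSuccAbove μ 0).symm
    rw [← hmp.map_eq]
    refine CorrBound.map (MeasurableEquiv.measurable _) (by fun_prop) (by fun_prop) ?_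
    have hp := CorrBound.prod (by fun_prop) (by fun_prop) (h 0)
      (ih (fun j => μ (Fin.succAbove 0 j)) fun j => h _)
    intro f g hf hg hfL hgL
    have hcU : ∀ w : Ω × (Fin n → Ω),
        (fun i => U ((MeasurableEquiv.piFinSuccAbove (fun _ => Ω) 0).symm w i)) =
          (MeasurableEquiv.piFinSuccAbove (fun _ => 𝒰) 0).symm (U w.1, fun i => U (w.2 i)) := by
      intro w; funext i
      refine Fin.cases ?_ (fun j => ?_) i <;> simp [MeasurableEquiv.piFinSuccAbove]
    have hcV : ∀ w : Ω × (Fin n → Ω),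
        (fun i => V ((MeasurableEquiv.piFinSuccAbove (fun _ => Ω) 0).symm w i)) =
          (MeasurableEquiv.piFinSuccAbove (fun _ => 𝒱) 0).symm (V w.1, fun i => V (w.2 i)) := by
      intro w; funext i
      refine Fin.cases ?_ (fun j => ?_) i <;> simp [MeasurableEquiv.piFinSuccAbove]
    simp only [hcU, hcV] at hfL hgL ⊢
    exact hp _ _ (hf.comp (MeasurableEquiv.measurable _)) (hg.comp (MeasurableEquiv.measurable _))
      hfL hgL

end Tensorization

/-! ### Independence of the triples under a memoryless filter. -/

section JointLaw

instance {𝒳 𝒴 𝒵 : Type*} [MeasurableSpace 𝒳] [MeasurableSpace 𝒴] [MeasurableSpace 𝒵]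
    (P : Measure (𝒳 × 𝒴)) [IsProbabilityMeasure P] (κ : Kernel 𝒴 𝒵) [IsMarkovKernel κ] :
    IsProbabilityMeasure (jointLaw P κ) := by
  unfold jointLaw; infer_instance

lemma jointLaw_map_fst {𝒳 𝒴 𝒵 : Type*} [MeasurableSpace 𝒳] [MeasurableSpace 𝒴] [MeasurableSpace 𝒵]
    (P : Measure (𝒳 × 𝒴)) [IsProbabilityMeasure P] (κ : Kernel 𝒴 𝒵) [IsMarkovKernel κ] :
    (jointLaw P κ).map Prod.fst = P :=
  Measure.fst_compProd P _

instance (n : ℕ) (P : Measure (ℝ × ℝ)) [IsProbabilityMeasure P] :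
    IsProbabilityMeasure (iidLaw n P) :=
  Measure.isProbabilityMeasure_map (by fun_prop)

lemma variance_jointLaw {P : Measure (ℝ × ℝ)} [IsProbabilityMeasure P] (κ : Kernel ℝ ℝ)
    [IsMarkovKernel κ] {u : ℝ × ℝ → ℝ} (hu : Measurable u) :
    Var[fun w => u w.1; jointLaw P κ] = Var[u; P] := by
  have h := variance_map (μ := jointLaw P κ) (X := u) (Y := Prod.fst) hu.aemeasurable
    measurable_fst.aemeasurable
  rw [jointLaw_map_fst] at h
  exact h.symm

lemma memLp_jointLaw {P : Measure (ℝ × ℝ)} [IsProbabilityMeasure P] (κ : Kernel ℝ ℝ)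
    [IsMarkovKernel κ] {u : ℝ × ℝ → ℝ} (hu : MemLp u 2 P) :
    MemLp (fun w => u w.1) 2 (jointLaw P κ) := by
  have h : MemLp u 2 ((jointLaw P κ).map Prod.fst) := by rwa [jointLaw_map_fst]
  exact h.comp_of_map measurable_fst.aemeasurable

/-- Reorder an `n`-tuple of triples `((xᵢ, yᵢ), zᵢ)` into a triple `((xⁿ, yⁿ), zⁿ)` of
`n`-tuples. -/
def tripleOfTuples {n : ℕ} (w : Fin n → (ℝ × ℝ) × ℝ) :
    ((Fin n → ℝ) × (Fin n → ℝ)) × (Fin n → ℝ) :=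
  ((fun i => (w i).1.1, fun i => (w i).1.2), fun i => (w i).2)

lemma measurable_tripleOfTuples {n : ℕ} : Measurable (tripleOfTuples (n := n)) := by
  unfold tripleOfTuples; fun_prop

/-- A memoryless channel applied to an i.i.d. source gives independent triples. -/
lemma jointLaw_iidLaw {n : ℕ} {P : Measure (ℝ × ℝ)} [IsProbabilityMeasure P]
    {κ : Fin n → Kernel ℝ ℝ} [∀ i, IsMarkovKernel (κ i)]
    {W : Kernel (Fin n → ℝ) (Fin n → ℝ)} [IsMarkovKernel W]
    (hW : ∀ y, W y = Measure.pi fun i => κ i (y i)) :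
    jointLaw (iidLaw n P) W = (Measure.pi fun i => jointLaw P (κ i)).map tripleOfTuples := by
  set tuple : ((Fin n → ℝ) × (Fin n → ℝ)) × (Fin n → ℝ) → Fin n → (ℝ × ℝ) × ℝ :=
    fun w i => ((w.1.1 i, w.1.2 i), w.2 i) with htuple
  have hm : Measurable tuple := by fun_prop
  -- It suffices to compare boxes. There the channel contributes a product of functions of the
  -- single pairs `(xᵢ, yᵢ)`, whose integral factorizes by independence.
  have key : Measure.pi (fun i => jointLaw P (κ i)) = (jointLaw (iidLaw n P) W).map tuple := by
    refine Measure.pi_eq fun s hs => ?_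
    have hsm : MeasurableSet (Set.univ.pi s) := MeasurableSet.univ_pi hs
    rw [Measure.map_apply hm hsm, jointLaw, Measure.compProd_apply (hm hsm)]
    have hfac : ∀ i, Measurable fun p : ℝ × ℝ => κ i p.2 (Prod.mk p ⁻¹' s i) := fun i =>
      Kernel.measurable_kernel_prodMk_left (κ := (κ i).comap Prod.snd measurable_snd) (hs i)
    have hslice : ∀ a : (Fin n → ℝ) × (Fin n → ℝ),
        W a.2 (Prod.mk a ⁻¹' (tuple ⁻¹' Set.univ.pi s)) =
          ∏ i, κ i (a.2 i) (Prod.mk (a.1 i, a.2 i) ⁻¹' s i) := by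
      intro a
      rw [hW, ← Measure.pi_pi]
      congr 1
    simp_rw [Kernel.comap_apply, hslice]
    rw [iidLaw, lintegral_map ?_ (by fun_prop)]
    · have hind := iIndepFun_pi (μ := fun _ : Fin n => P)
        (X := fun i (p : ℝ × ℝ) => κ i p.2 (Prod.mk p ⁻¹' s i)) fun i => (hfac i).aemeasurable
      have h := lintegral_prod_eq_prod_lintegral_of_indepFun Finset.univ _ hind
        fun i => (hfac i).comp (measurable_pi_apply i)
      refine h.trans (Finset.prod_congr rfl fun i _ => ?_)
      rw [jointLaw, Measure.compProd_apply (hs i)]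
      have := (measurePreserving_eval (fun _ : Fin n => P) i).lintegral_comp (hfac i)
      exact this
    · exact Finset.measurable_prod _ fun i _ =>
        (hfac i).comp (by fun_prop : Measurable fun a : (Fin n → ℝ) × (Fin n → ℝ) =>
          (a.1 i, a.2 i))
  rw [key, Measure.map_map measurable_tripleOfTuples hm]
  exact Measure.map_id.symm

/-- The memoryless channel with the given components. -/
lemma exists_memoryless_kernel {n : ℕ} (κ : Fin n → Kernel ℝ ℝ) [∀ i, IsMarkovKernel (κ i)] :
    ∃ W : Kernel (Fin n → ℝ) (Fin n → ℝ), IsMarkovKernel W ∧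
      ∀ y, W y = Measure.pi fun i => κ i (y i) := by
  have hmeas : Measurable fun y : Fin n → ℝ => Measure.pi fun i => κ i (y i) := by
    refine Measurable.measure_of_isPiSystem_of_isProbabilityMeasure generateFrom_pi.symm
      isPiSystem_pi ?_
    rintro _ ⟨s, hs, rfl⟩
    simp only [Measure.pi_pi]
    exact Finset.measurable_prod _ fun i _ =>
      ((κ i).measurable_coe (hs i (Set.mem_univ i))).comp (measurable_pi_apply i)
  exact ⟨⟨_, hmeas⟩, ⟨fun y => inferInstanceAs (IsProbabilityMeasure (Measure.pi _))⟩,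
    fun y => rfl⟩

end JointLaw

/-! ### Single-letter estimation from independent observations. -/

section Independence

variable {Ω 𝒱 : Type*} [MeasurableSpace Ω] [MeasurableSpace 𝒱]

/-- Independent observations do not help estimation. -/
lemma emmse_pi {n : ℕ} (μ : Fin n → Measure Ω) [∀ i, IsProbabilityMeasure (μ i)]
    {u : Ω → ℝ} {v : Ω → 𝒱} (hu : Measurable u) (hv : Measurable v) (i : Fin n) :
    emmse (Measure.pi μ) (fun w => u (w i)) (fun w j => v (w j)) = emmse (μ i) u v := by
  refine le_antisymm (le_iInf fun g => ?_) (le_iInf fun g => ?_)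
  · have hg := g.2
    refine (emmse_le_mse _ _ _ (hg.comp (measurable_pi_apply i))).trans (le_of_eq ?_)
    exact (measurePreserving_eval μ i).lintegral_comp
      (f := fun ω => ENNReal.ofReal ((u ω - g.1 (v ω)) ^ 2)) (by fun_prop)
  · obtain ⟨m, rfl⟩ : ∃ m, n = m + 1 := ⟨n - 1, by have := i.pos; omega⟩
    have hg := g.2
    have hmp := (measurePreserving_piFinSuccAbove μ i).symm
    -- By Tonelli, coordinate `i` is integrated first. With the other coordinates `r` frozen, `g`
    -- becomes an estimator from `v x` alone, so each inner integral is at least the single-letter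
    -- optimum.
    rw [mse, ← hmp.lintegral_comp (by fun_prop), lintegral_prod_symm _ (by fun_prop)]
    calc emmse (μ i) u v
        = ∫⁻ _, emmse (μ i) u v ∂(Measure.pi fun j => μ (i.succAbove j)) := by simp
      _ ≤ _ := by
        refine lintegral_mono fun r => ?_
        refine (emmse_le_mse (μ i) u v (g := fun z => g.1 (i.insertNth z fun j => v (r j)))
          ?_).trans (le_of_eq ?_)
        · refine hg.comp ?_
          have h : Measurable fun z : 𝒱 =>
              (MeasurableEquiv.piFinSuccAbove (fun _ => 𝒱) i).symm (z, fun j => v (r j)) :=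
            (MeasurableEquiv.measurable _).comp (by fun_prop)
          exact h
        · refine lintegral_congr fun x => ?_
          have h1 : (MeasurableEquiv.piFinSuccAbove (fun _ => Ω) i).symm (x, r) =
              i.insertNth x r := rfl
          have h2 : (fun j => v (i.insertNth (α := fun _ => Ω) x r j)) =
              i.insertNth (v x) fun j => v (r j) := by
            funext j
            refine Fin.succAboveCases i ?_ (fun k => ?_) j <;> simp
          simp only [h1, h2, Fin.insertNth_apply_same]

end Independence

section Memoryless

variable {n : ℕ} {P : Measure (ℝ × ℝ)} [IsProbabilityMeasure P]
  {κ : Fin n → Kernel ℝ ℝ} [∀ i, IsMarkovKernel (κ i)]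
  {W : Kernel (Fin n → ℝ) (Fin n → ℝ)} [IsMarkovKernel W]

lemma mmse_memoryless (hW : ∀ y, W y = Measure.pi fun i => κ i (y i)) {u : ℝ × ℝ → ℝ}
    (hu : Measurable u) (i : Fin n) :
    mmse (jointLaw (iidLaw n P) W) (fun w => u (w.1.1 i, w.1.2 i)) (fun w => w.2) =
      mmse (jointLaw P (κ i)) (fun w => u w.1) (fun w => w.2) := by
  rw [jointLaw_iidLaw hW, mmse_map measurable_tripleOfTuples (by fun_prop) (by fun_prop),
    mmse_eq_toReal_emmse, mmse_eq_toReal_emmse]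
  congr 1
  exact emmse_pi (fun i => jointLaw P (κ i)) (u := fun w => u w.1) (v := fun w => w.2)
    (by fun_prop) (by fun_prop) i

lemma measurePreserving_memoryless (hW : ∀ y, W y = Measure.pi fun i => κ i (y i)) (i : Fin n) :
    MeasurePreserving (fun w : ((Fin n → ℝ) × (Fin n → ℝ)) × (Fin n → ℝ) =>
      ((w.1.1 i, w.1.2 i), w.2 i)) (jointLaw (iidLaw n P) W) (jointLaw P (κ i)) := by
  refine ⟨by fun_prop, ?_⟩
  rw [jointLaw_iidLaw hW, Measure.map_map (by fun_prop) measurable_tripleOfTuples]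
  exact (measurePreserving_eval (fun i => jointLaw P (κ i)) i).map_eq

lemma variance_memoryless (hW : ∀ y, W y = Measure.pi fun i => κ i (y i)) {u : ℝ × ℝ → ℝ}
    (hu : Measurable u) (i : Fin n) :
    Var[fun w => u (w.1.1 i, w.1.2 i); jointLaw (iidLaw n P) W] = Var[u; P] := by
  rw [← variance_jointLaw (κ i) hu]
  exact (measurePreserving_memoryless hW i).variance_fun_comp
    (f := fun w => u w.1) (by fun_prop)

lemma memLp_memoryless (hW : ∀ y, W y = Measure.pi fun i => κ i (y i)) {u : ℝ × ℝ → ℝ}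
    (hu : MemLp u 2 P) (i : Fin n) :
    MemLp (fun w => u (w.1.1 i, w.1.2 i)) 2 (jointLaw (iidLaw n P) W) :=
  (memLp_jointLaw (κ i) hu).comp_measurePreserving (measurePreserving_memoryless hW i)

lemma corrRatioSq_memoryless (hW : ∀ y, W y = Measure.pi fun i => κ i (y i)) {u : ℝ × ℝ → ℝ}
    (hu : Measurable u) (huL : MemLp u 2 P) (i : Fin n) :
    corrRatioSq (jointLaw (iidLaw n P) W) (fun w => u (w.1.1 i, w.1.2 i)) (fun w => w.2) =
      corrRatioSq (jointLaw P (κ i)) (fun w => u w.1) (fun w => w.2) := by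
  rw [corrRatioSq_eq measurable_snd (memLp_memoryless hW huL i),
    corrRatioSq_eq measurable_snd (memLp_jointLaw (κ i) huL), mmse_memoryless hW hu,
    variance_memoryless hW hu, variance_jointLaw _ hu]

end Memoryless

/-! ### Time sharing of channels. -/

section TimeSharing

variable {n : ℕ}

/-- An encoding of an index and an output letter into one real letter. -/
noncomputable def indexEncoding (n : ℕ) : Fin n × ℝ → ℝ := embeddingReal (Fin n × ℝ)

lemma measurableEmbedding_indexEncoding : MeasurableEmbedding (indexEncoding n) :=
  measurableEmbedding_embeddingReal _

lemma measurable_indexEncoding (i : Fin n) : Measurable fun z => indexEncoding n (i, z) :=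
  measurableEmbedding_indexEncoding.measurable.comp measurable_prodMk_left

/-- The channel that uses `κ i` for an index `i` drawn uniformly at random, and reveals `i`. -/
noncomputable def timeSharing (κ : Fin n → Kernel ℝ ℝ) : Kernel ℝ ℝ where
  toFun y := (n : ENNReal)⁻¹ • ∑ i, (κ i y).map fun z => indexEncoding n (i, z)
  measurable' := by
    refine Measure.measurable_of_measurable_coe _ fun s hs => ?_
    simp only [Measure.smul_apply, Measure.finsetSum_apply, smul_eq_mul]
    refine (Finset.measurable_sum _ fun i _ => ?_).const_mul _
    simp only [Measure.map_apply (measurable_indexEncoding i) hs]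
    exact (κ i).measurable_coe (measurable_indexEncoding i hs)

lemma timeSharing_apply (κ : Fin n → Kernel ℝ ℝ) (y : ℝ) :
    timeSharing κ y = (n : ENNReal)⁻¹ • ∑ i, (κ i y).map fun z => indexEncoding n (i, z) := rfl

variable {κ : Fin n → Kernel ℝ ℝ} [∀ i, IsMarkovKernel (κ i)]

lemma isMarkovKernel_timeSharing (hn : n ≠ 0) : IsMarkovKernel (timeSharing κ) := by
  refine ⟨fun y => ⟨?_⟩⟩
  rw [timeSharing_apply, Measure.smul_apply, Measure.finsetSum_apply, smul_eq_mul]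
  simp only [Measure.map_apply (measurable_indexEncoding _) MeasurableSet.univ, Set.preimage_univ,
    measure_univ, Finset.sum_const, Finset.card_univ, Fintype.card_fin, nsmul_eq_mul, mul_one]
  exact ENNReal.inv_mul_cancel (by exact_mod_cast hn) (ENNReal.natCast_ne_top n)

lemma lintegral_jointLaw_timeSharing (hn : n ≠ 0) {P : Measure (ℝ × ℝ)} [IsProbabilityMeasure P]
    {F : (ℝ × ℝ) × ℝ → ENNReal} (hF : Measurable F) :
    ∫⁻ w, F w ∂(jointLaw P (timeSharing κ)) =
      (n : ENNReal)⁻¹ * ∑ i, ∫⁻ w, F (w.1, indexEncoding n (i, w.2)) ∂(jointLaw P (κ i)) := by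
  have := isMarkovKernel_timeSharing hn (κ := κ)
  have hFi : ∀ i : Fin n, Measurable fun w : (ℝ × ℝ) × ℝ => F (w.1, indexEncoding n (i, w.2)) :=
    fun i => hF.comp (measurable_fst.prodMk ((measurable_indexEncoding i).comp measurable_snd))
  simp only [jointLaw]
  rw [Measure.lintegral_compProd hF]
  simp_rw [Measure.lintegral_compProd (hFi _)]
  rw [← lintegral_finsetSum _ fun i _ => (hFi i).lintegral_kernel_prod_right',
    ← lintegral_const_mul _
      (Finset.measurable_sum _ fun i _ => (hFi i).lintegral_kernel_prod_right')]
  refine lintegral_congr fun a => ?_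
  rw [Kernel.comap_apply, timeSharing_apply, lintegral_smul_measure, lintegral_finsetSum_measure,
    smul_eq_mul]
  congr 1
  refine Finset.sum_congr rfl fun i _ => ?_
  exact lintegral_map (hF.comp measurable_prodMk_left) (measurable_indexEncoding i)

/-- Time sharing averages the minimum mean-squared error. -/
lemma mmse_timeSharing (hn : n ≠ 0) {P : Measure (ℝ × ℝ)} [IsProbabilityMeasure P] {u : ℝ × ℝ → ℝ}
    (hu : Measurable u) (huL : MemLp u 2 P) :
    mmse (jointLaw P (timeSharing κ)) (fun w => u w.1) (fun w => w.2) =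
      (n : ℝ)⁻¹ * ∑ i, mmse (jointLaw P (κ i)) (fun w => u w.1) (fun w => w.2) := by
  have hmse : ∀ g : ℝ → ℝ, Measurable g →
      mse (jointLaw P (timeSharing κ)) (fun w => u w.1) (fun w => w.2) g =
      (n : ENNReal)⁻¹ * ∑ i, mse (jointLaw P (κ i)) (fun w => u w.1) (fun w => w.2)
        fun z => g (indexEncoding n (i, z)) := fun g hg =>
    lintegral_jointLaw_timeSharing hn
      (F := fun w => ENNReal.ofReal ((u w.1 - g w.2) ^ 2)) (by fun_prop)
  have key : emmse (jointLaw P (timeSharing κ)) (fun w => u w.1) (fun w => w.2) =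
      (n : ENNReal)⁻¹ * ∑ i, emmse (jointLaw P (κ i)) (fun w => u w.1) (fun w => w.2) := by
    refine le_antisymm ?_ (le_iInf fun g => ?_)
    · choose g hg hge using fun i =>
        exists_mse_eq_emmse (μ := jointLaw P (κ i)) measurable_snd (memLp_jointLaw (κ i) huL)
      -- The output letter reveals the index, so the optimal estimators of the components glue into
      -- one, extended measurably off the range of the encoding.
      have hgm : Measurable fun p : Fin n × ℝ => g p.1 p.2 := measurable_from_prod_countable_right hg
      obtain ⟨g', hg', hgg'⟩ :=
        measurableEmbedding_indexEncoding.exists_measurable_extend hgm fun _ => inferInstance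
      refine (emmse_le_mse _ _ _ hg').trans (le_of_eq ?_)
      rw [hmse g' hg']
      congr 1
      refine Finset.sum_congr rfl fun i _ => ?_
      rw [hge]
      congr 1
      funext z
      exact congrFun hgg' (i, z)
    -- Conversely, any estimator for the mixture restricts to an estimator for each component.
    · rw [hmse g.1 g.2]
      gcongr with i
      exact emmse_le_mse _ _ _ (g.2.comp (measurable_indexEncoding i))
  simp only [mmse_eq_toReal_emmse]
  rw [key, ENNReal.toReal_mul, ENNReal.toReal_sum fun i _ =>
    emmse_ne_top measurable_snd (memLp_jointLaw (κ i) huL)]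
  simp

lemma timeSharing_mem (hn : n ≠ 0) {𝒦 : Set (Kernel ℝ ℝ)} (h𝒦 : 𝒦 = finiteChannels ∨ 𝒦 = realChannels)
    (hκ : ∀ i, κ i ∈ 𝒦) : timeSharing κ ∈ 𝒦 := by
  have hM := isMarkovKernel_timeSharing hn (κ := κ)
  rcases h𝒦 with rfl | rfl
  · choose A hA hκA using fun i => (hκ i).2
    refine ⟨hM, ⋃ i, (fun z => indexEncoding n (i, z)) '' A i,
      Set.finite_iUnion fun i => (hA i).image _, fun y => ?_⟩
    have hfin : (⋃ i, (fun z => indexEncoding n (i, z)) '' A i).Finite :=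
      Set.finite_iUnion fun i => (hA i).image _
    rw [timeSharing_apply, Measure.smul_apply, Measure.finsetSum_apply]
    rw [Finset.sum_eq_zero, smul_zero]
    intro i _
    rw [Measure.map_apply (measurable_indexEncoding i) hfin.measurableSet.compl]
    refine measure_mono_null ?_ (hκA i y)
    exact fun z hz hzA => hz (Set.mem_iUnion.2 ⟨i, z, hzA, rfl⟩)
  · exact hM

end TimeSharing

lemma isMarkovKernel_of_mem {𝒦 : Set (Kernel ℝ ℝ)}
    (h𝒦 : 𝒦 = finiteChannels ∨ 𝒦 = realChannels) {κ : Kernel ℝ ℝ} (hκ : κ ∈ 𝒦) :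
    IsMarkovKernel κ := by
  rcases h𝒦 with rfl | rfl
  · exact hκ.1
  · exact hκ

/-! ### The constant filter, feasible for every `ε ≥ 0`. -/

section ConstantChannel

lemma const_mem {𝒦 : Set (Kernel ℝ ℝ)} (h𝒦 : 𝒦 = finiteChannels ∨ 𝒦 = realChannels) :
    Kernel.const ℝ (Measure.dirac (0 : ℝ)) ∈ 𝒦 := by
  have hM : IsMarkovKernel (Kernel.const ℝ (Measure.dirac (0 : ℝ))) := inferInstance
  rcases h𝒦 with rfl | rfl
  · exact ⟨hM, {0}, Set.finite_singleton 0, fun y => by simp⟩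
  · exact hM

lemma mmse_const {P : Measure (ℝ × ℝ)} [IsProbabilityMeasure P] {U : (ℝ × ℝ) × ℝ → ℝ}
    (hU : MemLp U 2 (jointLaw P (Kernel.const ℝ (Measure.dirac (0 : ℝ))))) :
    mmse (jointLaw P (Kernel.const ℝ (Measure.dirac (0 : ℝ)))) U (fun w => w.2) =
      Var[U; jointLaw P (Kernel.const ℝ (Measure.dirac (0 : ℝ)))] := by
  refine mmse_eq_variance_of_const hU measurable_snd (z := 0) ?_
  have hs : MeasurableSet {w : (ℝ × ℝ) × ℝ | ¬ w.2 = 0} :=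
    (measurable_snd (measurableSet_singleton (0 : ℝ))).compl
  rw [ae_iff, jointLaw, Measure.compProd_apply hs]
  simp

lemma const_mem_strongFilters {𝒦 : Set (Kernel ℝ ℝ)}
    (h𝒦 : 𝒦 = finiteChannels ∨ 𝒦 = realChannels) {ε : ℝ} (hε : 0 ≤ ε) (P : Measure (ℝ × ℝ))
    [IsProbabilityMeasure P] :
    Kernel.const ℝ (Measure.dirac (0 : ℝ)) ∈ strongFilters 𝒦 ε P := by
  refine ⟨const_mem h𝒦, fun f _ hfL hfV => ?_⟩
  rw [mmse_const hfL]
  nlinarith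

lemma const_mem_weakFilters {𝒦 : Set (Kernel ℝ ℝ)}
    (h𝒦 : 𝒦 = finiteChannels ∨ 𝒦 = realChannels) {ε : ℝ} (hε : 0 ≤ ε) {P : Measure (ℝ × ℝ)}
    [IsProbabilityMeasure P] (hX : MemLp (fun p : ℝ × ℝ => p.1) 2 P) :
    Kernel.const ℝ (Measure.dirac (0 : ℝ)) ∈ weakFilters 𝒦 ε P := by
  refine ⟨const_mem h𝒦, ?_⟩
  rw [mmse_const (memLp_jointLaw _ hX)]
  nlinarith [variance_nonneg (fun w : (ℝ × ℝ) × ℝ => w.1.1)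
    (jointLaw P (Kernel.const ℝ (Measure.dirac (0 : ℝ))))]

end ConstantChannel

lemma ensr_nonneg (P : Measure (ℝ × ℝ)) (κ : Kernel ℝ ℝ) : 0 ≤ ensr P κ :=
  div_nonneg (mmse_nonneg ..) (variance_nonneg ..)

lemma ensr_timeSharing {P : Measure (ℝ × ℝ)} [IsProbabilityMeasure P]
    (hY : MemLp (fun p : ℝ × ℝ => p.2) 2 P) {n : ℕ} (hn : n ≠ 0) (κ : Fin n → Kernel ℝ ℝ)
    [∀ i, IsMarkovKernel (κ i)] :
    ensr P (timeSharing κ) = (n : ℝ)⁻¹ * ∑ i, ensr P (κ i) := by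
  have := isMarkovKernel_timeSharing hn (κ := κ)
  have hv := fun (κ' : Kernel ℝ ℝ) (_ : IsMarkovKernel κ') =>
    variance_jointLaw (P := P) κ' (u := fun p => p.2) measurable_snd
  simp only [ensr, hv _ inferInstance]
  rw [mmse_timeSharing hn (u := fun p => p.2) measurable_snd hY, mul_div_assoc, Finset.sum_div]

lemma sumCorrRatioSq_memoryless {P : Measure (ℝ × ℝ)} [IsProbabilityMeasure P]
    (hY : MemLp (fun p : ℝ × ℝ => p.2) 2 P) (hvarY : 0 < Var[fun p : ℝ × ℝ => p.2; P])
    {n : ℕ} {κ : Fin n → Kernel ℝ ℝ} [∀ i, IsMarkovKernel (κ i)]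
    {W : Kernel (Fin n → ℝ) (Fin n → ℝ)} [IsMarkovKernel W]
    (hW : ∀ y, W y = Measure.pi fun i => κ i (y i)) :
    sumCorrRatioSq (iidLaw n P) W = ∑ i, (1 - ensr P (κ i)) := by
  refine Finset.sum_congr rfl fun i _ => ?_
  rw [corrRatioSq_memoryless hW (u := fun p => p.2) measurable_snd hY,
    corrRatioSq_eq measurable_snd (memLp_jointLaw (κ i) hY), ensr,
    variance_jointLaw (κ i) (u := fun p => p.2) measurable_snd, sub_div, div_self hvarY.ne']

/-- Here `B` stands for the single-letter noise ratios and `A` for the total utilities: `hBA` is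
achievability by repetition, `hAB` is the converse. Nonemptiness keeps `sSup` and `sInf` from taking
their default value `0`. -/
lemma one_sub_sSup_div_eq_sInf {n : ℕ} (hn : n ≠ 0) {A B : Set ℝ} (hB : B.Nonempty)
    (hBA : ∀ b ∈ B, (n : ℝ) * (1 - b) ∈ A)
    (hAB : ∀ a ∈ A, a ≤ n * (1 - sInf B)) :
    1 - 1 / (n : ℝ) * sSup A = sInf B := by
  have hn' : (0 : ℝ) < n := by exact_mod_cast Nat.pos_of_ne_zero hn
  have h : sSup A = n * (1 - sInf B) := by
    obtain ⟨b, hb⟩ := hB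
    refine le_antisymm (csSup_le ⟨_, hBA b hb⟩ hAB) ?_
    have h1 : 1 - sSup A / n ≤ sInf B := by
      refine le_csInf ⟨b, hb⟩ fun c hc => ?_
      have h2 := le_csSup ⟨_, hAB⟩ (hBA c hc)
      rw [mul_comm, ← le_div_iff₀ hn'] at h2
      linarith
    rw [mul_comm, ← le_div_iff₀ hn']
    linarith
  rw [h]
  field_simp
  ring

/-! ### Privacy of memoryless and time-shared filters. -/

section MemorylessFilters

variable {n : ℕ} {P : Measure (ℝ × ℝ)} [IsProbabilityMeasure P] {𝒦 : Set (Kernel ℝ ℝ)} {ε : ℝ}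
  {κ : Fin n → Kernel ℝ ℝ} [∀ i, IsMarkovKernel (κ i)]
  {W : Kernel (Fin n → ℝ) (Fin n → ℝ)} [IsMarkovKernel W]

/-- The components of a strongly private memoryless filter are strongly private. -/
lemma mem_strongFilters_of_memoryless (hε : 0 ≤ ε) (hκ : ∀ i, κ i ∈ 𝒦)
    (hW : ∀ y, W y = Measure.pi fun i => κ i (y i))
    (h : maxCorrSq (jointLaw (iidLaw n P) W) (fun w => w.1.1) (fun w => w.2) ≤ ε) (i : Fin n) :
    κ i ∈ strongFilters 𝒦 ε P := by
  refine ⟨hκ i, fun f hf hfL _ => ?_⟩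
  have hfL' : MemLp (fun w : ((Fin n → ℝ) × (Fin n → ℝ)) × (Fin n → ℝ) => f (w.1.1 i)) 2
      (jointLaw (iidLaw n P) W) :=
    hfL.comp_measurePreserving (measurePreserving_memoryless hW i)
  have h1 := le_mmse_of_maxCorrSq_le measurable_snd hε h (f := fun x : Fin n → ℝ => f (x i))
    (hf.comp (measurable_pi_apply i)) hfL'
  have hu : Measurable fun p : ℝ × ℝ => f p.1 := hf.comp measurable_fst
  rw [mmse_memoryless hW hu i, variance_memoryless hW hu i] at h1
  rwa [variance_jointLaw (κ i) hu]

/-- Memoryless filters with strongly private components are strongly private. -/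
lemma maxCorrSq_memoryless_le (hε : 0 ≤ ε) (hκ : ∀ i, κ i ∈ strongFilters 𝒦 ε P)
    (hW : ∀ y, W y = Measure.pi fun i => κ i (y i)) :
    maxCorrSq (jointLaw (iidLaw n P) W) (fun w => w.1.1) (fun w => w.2) ≤ ε := by
  refine CorrBound.maxCorrSq_le ?_ hε
  rw [jointLaw_iidLaw hW]
  refine CorrBound.map measurable_tripleOfTuples (by fun_prop) (by fun_prop) ?_
  exact CorrBound.pi hε (U := fun w : (ℝ × ℝ) × ℝ => w.1.1) (V := fun w => w.2)
    (by fun_prop) (by fun_prop) n _ fun i => corrBound_of_mmse (hκ i).2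

lemma mem_weakFilters_iff (hX : MemLp (fun p : ℝ × ℝ => p.1) 2 P) (hε : 0 ≤ ε)
    {κ : Kernel ℝ ℝ} [IsMarkovKernel κ] :
    κ ∈ weakFilters 𝒦 ε P ↔
      κ ∈ 𝒦 ∧ corrRatioSq (jointLaw P κ) (fun w => w.1.1) (fun w => w.2) ≤ ε := by
  rw [corrRatioSq_le_iff measurable_snd (memLp_jointLaw κ hX) hε]
  rfl

lemma corrRatioSq_timeSharing (hX : MemLp (fun p : ℝ × ℝ => p.1) 2 P) (hn : n ≠ 0) :
    corrRatioSq (jointLaw P (timeSharing κ)) (fun w => w.1.1) (fun w => w.2) =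
      (n : ℝ)⁻¹ * ∑ i, corrRatioSq (jointLaw P (κ i)) (fun w => w.1.1) (fun w => w.2) := by
  have := isMarkovKernel_timeSharing hn (κ := κ)
  have hc := fun (κ' : Kernel ℝ ℝ) (_ : IsMarkovKernel κ') =>
    corrRatioSq_eq (μ := jointLaw P κ') measurable_snd (memLp_jointLaw κ' hX)
  have hv := fun (κ' : Kernel ℝ ℝ) (_ : IsMarkovKernel κ') =>
    variance_jointLaw (P := P) κ' (u := fun p => p.1) measurable_fst
  simp only [hc _ inferInstance, hv _ inferInstance]
  rw [mmse_timeSharing hn (u := fun p => p.1) measurable_fst hX, ← Finset.sum_div,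
    ← mul_div_assoc, Finset.sum_sub_distrib]
  have hn' : (n : ℝ) ≠ 0 := by exact_mod_cast hn
  congr 1
  simp only [Finset.sum_const, Finset.card_univ, Fintype.card_fin, nsmul_eq_mul]
  field_simp

end MemorylessFilters

end PrivacyMMSE

open PrivacyMMSE

theorem proposition2
    (P : Measure (ℝ × ℝ)) [IsProbabilityMeasure P]
    (hY : MemLp (fun p : ℝ × ℝ => p.2) 2 P)
    (hvarY : 0 < Var[fun p : ℝ × ℝ => p.2; P])
    (𝒦 : Set (Kernel ℝ ℝ))
    (h𝒦 : 𝒦 = PrivacyMMSE.finiteChannels ∨ 𝒦 = PrivacyMMSE.realChannels)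
    (n : ℕ) (hn : 1 ≤ n) (ε : ℝ) (hε : 0 ≤ ε) :
    PrivacyMMSE.strongENSRN (PrivacyMMSE.memorylessChannels n 𝒦) ε (PrivacyMMSE.iidLaw n P) =
        PrivacyMMSE.strongENSR 𝒦 ε P ∧
      (MemLp (fun p : ℝ × ℝ => p.1) 2 P →
        PrivacyMMSE.weakENSRN (PrivacyMMSE.memorylessChannels n 𝒦) ε (PrivacyMMSE.iidLaw n P) =
          PrivacyMMSE.weakENSR 𝒦 ε P) := by
  have hn0 : n ≠ 0 := Nat.one_le_iff_ne_zero.1 hn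
  have hn' : (0 : ℝ) < n := by exact_mod_cast hn
  have hbdd : ∀ S : Set (Kernel ℝ ℝ), BddBelow (ensr P '' S) := fun S =>
    ⟨0, by rintro _ ⟨κ, -, rfl⟩; exact ensr_nonneg P κ⟩
  refine ⟨?_, fun hX => ?_⟩
  · refine one_sub_sSup_div_eq_sInf hn0
      (Set.Nonempty.image _ ⟨_, const_mem_strongFilters h𝒦 hε P⟩) ?_ ?_
    · rintro _ ⟨κ, hκ, rfl⟩
      have := isMarkovKernel_of_mem h𝒦 hκ.1
      obtain ⟨W, hWM, hW⟩ := exists_memoryless_kernel fun _ : Fin n => κ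
      refine ⟨W, ⟨hWM, ⟨fun _ => κ, fun _ => hκ.1, hW⟩,
        maxCorrSq_memoryless_le hε (fun _ => hκ) hW⟩, ?_⟩
      rw [sumCorrRatioSq_memoryless hY hvarY hW]
      simp [mul_sub]
    · rintro _ ⟨W, ⟨hWM, ⟨κ, hκ, hW⟩, hWε⟩, rfl⟩
      have := fun i => isMarkovKernel_of_mem h𝒦 (hκ i)
      rw [sumCorrRatioSq_memoryless hY hvarY hW]
      -- Every component is itself strongly private, so the bound holds term by term.
      refine (Finset.sum_le_card_nsmul _ _ (1 - strongENSR 𝒦 ε P) fun i _ => ?_).trans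
        (by simp [strongENSR])
      exact sub_le_sub_left (csInf_le (hbdd _)
        ⟨κ i, mem_strongFilters_of_memoryless hε hκ hW hWε i, rfl⟩) 1
  · refine one_sub_sSup_div_eq_sInf hn0
      (Set.Nonempty.image _ ⟨_, const_mem_weakFilters h𝒦 hε hX⟩) ?_ ?_
    · rintro _ ⟨κ, hκ, rfl⟩
      have := isMarkovKernel_of_mem h𝒦 hκ.1
      obtain ⟨W, hWM, hW⟩ := exists_memoryless_kernel fun _ : Fin n => κ
      refine ⟨W, ⟨hWM, ⟨fun _ => κ, fun _ => hκ.1, hW⟩, ?_⟩, ?_⟩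
      · refine (Finset.sum_le_card_nsmul _ _ ε fun i _ => ?_).trans (by simp)
        rw [corrRatioSq_memoryless hW (u := fun p => p.1) measurable_fst hX]
        exact ((mem_weakFilters_iff hX hε).1 hκ).2
      · rw [sumCorrRatioSq_memoryless hY hvarY hW]
        simp [mul_sub]
    · rintro _ ⟨W, ⟨hWM, ⟨κ, hκ, hW⟩, hWε⟩, rfl⟩
      have := fun i => isMarkovKernel_of_mem h𝒦 (hκ i)
      have hM := isMarkovKernel_timeSharing hn0 (κ := κ)
      -- A term-by-term bound is not available here, since the constraint controls only the sum of
      -- the leakages; the time-shared channel turns that sum into the leakage of one filter.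
      have hmem : timeSharing κ ∈ weakFilters 𝒦 ε P := by
        refine (mem_weakFilters_iff hX hε).2 ⟨timeSharing_mem hn0 h𝒦 hκ, ?_⟩
        simp only [corrRatioSq_memoryless hW (u := fun p => p.1) measurable_fst hX] at hWε
        rwa [corrRatioSq_timeSharing hX hn0, inv_mul_le_iff₀ hn']
      have h := csInf_le (hbdd _) (Set.mem_image_of_mem (ensr P) hmem)
      rw [ensr_timeSharing hY hn0, le_inv_mul_iff₀ hn'] at h
      rw [sumCorrRatioSq_memoryless hY hvarY hW, Finset.sum_sub_distrib]
      simp only [Finset.sum_const, Finset.card_univ, Fintype.card_fin, nsmul_eq_mul]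
      linarith
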